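/- Let $k$ be a field and let $X$ be a nonempty well-ordered set. **The free Leibniz algebra.** A (right) Leibniz algebra is a $k$-vector space with a bilinear product satisfying $x(yz)=(xy)z-(xz)y$; let $\mathrm{Lb}(X)$ be the free one on $X$, i.e. the quotient of the free nonassociative $k$-algebra on $X$ by the ideal generated by all $x(yz)-(xy)z+(xz)y$. Put $[f_1f_2\cdots f_n]=((\cdots((f_1f_2)f_3)\cdots)f_n)$. The elements $[a_1\cdots a_n]$ with $n\ge 1$ and $a_i\in X$ are pairwise distinct for distinct words $a_1\cdots a_n$, and the set $NF(X)$ of all of them is a linear basis of $\mathrm{Lb}(X)$. Every letter has degree $1$, so that $\deg[a_1\cdots a_n]=\ell([a_1\cdots a_n])=n$, and $NF(X)$ is ordered by comparing $(\deg,\ell,a_1,\dots,a_n)$ lexicographically. For $0\ne f\in\mathrm{Lb}(X)$ let $\bar f$ be the largest element of $NF(X)$ occurring in $f$; $f$ is monic if its coefficient is $1$. A set is monic if it is nonempty and all its elements are monic. **Gröbner–Shirshov bases.** Let $S\subseteq \mathrm{Lb}(X)$ be a monic set. A normal $S$-polynomial built on $s\in S$ is an element $[s\,a_1\cdots a_m]$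 with $m\ge 0$, or, if $\ell(\bar s)=1$, an element $[a_1\cdots a_t\,s\,a_{t+1}\cdots a_m]$ with $1\le t\le m$, where all $a_i\in X$. The set $S$ is a Gröbner–Shirshov basis in $\mathrm{Lb}(X)$ if 1. for all $f\in S$ with $\ell(\bar f)>1$ and all $\mu\in NF(X)$ with $\mu f\neq 0$, the product $\mu f$ is a linear combination of normal $S$-polynomials whose leading monomials have degree at most $\deg\mu+\deg\bar f$; 2. for all $f\ne g$ in $S$ and every normal $S$-polynomial $h$ built on $g$ with $\bar h=\bar f$, the element $f-h$ is a linear combination of normal $S$-polynomials with leading monomials smaller than $\bar f$. **Theorem.** Let $\mathrm{MLie}(X)=L/[[L,L],[L,L]]$, where $L$ is the free Lie algebra over $k$ on $X$, be the free metabelian Lie algebra on $X$. Let $S\subseteq\mathrm{Lb}(X)$ be the set of all elements $$[\mu a_1a_2]-[\mu a_2a_1],\qquad [bac]-[cab]+[cba],\qquad [a_1a_2]+[a_2a_1],\qquad [dd],$$ where $\mu\in NF(X)$ with $\ell(\mu)\ge 2$, and $a_1,a_2,a,b,c,d\in X$ with $a_2<a_1$ and $c<b<a$. Then: * $S$ is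 a Gröbner–Shirshov basis in $\mathrm{Lb}(X)$. * $S$ presents $\mathrm{MLie}(X)$: there is a surjective homomorphism $\mathrm{Lb}(X)\to\mathrm{MLie}(X)$ that is the identity on $X$ and whose kernel is the ideal of $\mathrm{Lb}(X)$ generated by $S$. * The left-normed words $[a_1a_2\cdots a_n]$ with $n\ge 1$, $a_i\in X$, $a_1<a_2$ and $a_1\le a_3\le a_4\le\cdots\le a_n$ (a condition being void if it involves a letter that does not occur, so that all $a_1\in X$ are included) form a linear basis of $\mathrm{MLie}(X)$; distinct words give distinct basis elements. -/

import Mathlib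

noncomputable section

namespace LeibnizGS

/-! ### Ideals, Leibniz algebras and the free Leibniz algebra -/

/-- The (two-sided) ideal of a nonassociative `k`-algebra generated by a set `S`: the smallest
subspace containing `S` that is stable under left and right multiplication. -/
def idealSpan (k : Type*) {A : Type*} [Field k] [NonUnitalNonAssocRing A] [Module k A]
    (S : Set A) : Submodule k A :=
  sInf {I : Submodule k A | S ⊆ I ∧ ∀ x : A, ∀ y ∈ I, x * y ∈ I ∧ y * x ∈ I}

section idealSpan

variable {k : Type*} {A : Type*} [Field k] [NonUnitalNonAssocRing A] [Module k A] {S : Set A}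

theorem subset_idealSpan : S ⊆ (idealSpan k S : Set A) := by
  intro s hs
  simp only [idealSpan, SetLike.mem_coe, Submodule.mem_sInf, Set.mem_ofPred_eq]
  exact fun I hI => hI.1 hs

theorem idealSpan_mul_left (x : A) {y : A} (hy : y ∈ idealSpan k S) :
    x * y ∈ idealSpan k S := by
  simp only [idealSpan, Submodule.mem_sInf, Set.mem_ofPred_eq] at hy ⊢
  exact fun I hI => (hI.2 x y (hy I hI)).1

theorem idealSpan_mul_right (x : A) {y : A} (hy : y ∈ idealSpan k S) :
    y * x ∈ idealSpan k S := by
  simp only [idealSpan, Submodule.mem_sInf, Set.mem_ofPred_eq] at hy ⊢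
  exact fun I hI => (hI.2 x y (hy I hI)).2

theorem idealSpan_le {I : Submodule k A} (hS : S ⊆ I)
    (hI : ∀ x : A, ∀ y ∈ I, x * y ∈ I ∧ y * x ∈ I) : idealSpan k S ≤ I :=
  sInf_le ⟨hS, hI⟩

end idealSpan

variable (k : Type*) (X : Type*) [Field k]

/-- The ideal of the free nonassociative algebra on `X` generated by all
`x(yz) - (xy)z + (xz)y`. -/
def leibnizIdeal : Submodule k (FreeNonUnitalNonAssocAlgebra k X) :=
  idealSpan k {f | ∃ x y z : FreeNonUnitalNonAssocAlgebra k X,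
    f = x * (y * z) - (x * y) * z + (x * z) * y}

/-- The free (right) Leibniz algebra `Lb(X)`: the quotient of the free nonassociative algebra on `X`
by the Leibniz identity `x(yz) = (xy)z - (xz)y`. -/
def Lb : Type _ := FreeNonUnitalNonAssocAlgebra k X ⧸ leibnizIdeal k X

namespace Lb

instance : AddCommGroup (Lb k X) :=
  inferInstanceAs (AddCommGroup (FreeNonUnitalNonAssocAlgebra k X ⧸ leibnizIdeal k X))

instance : Module k (Lb k X) :=
  inferInstanceAs (Module k (FreeNonUnitalNonAssocAlgebra k X ⧸ leibnizIdeal k X))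

/-- The quotient map from the free nonassociative algebra to `Lb(X)`. -/
def mk : FreeNonUnitalNonAssocAlgebra k X →ₗ[k] Lb k X := (leibnizIdeal k X).mkQ

theorem mk_surjective : Function.Surjective (mk k X) := Submodule.mkQ_surjective _

theorem mk_eq_zero {f : FreeNonUnitalNonAssocAlgebra k X} :
    mk k X f = 0 ↔ f ∈ leibnizIdeal k X := Submodule.Quotient.mk_eq_zero _

/-- The multiplication of `Lb(X)`, induced from the free nonassociative algebra. -/
def mulMap : Lb k X →ₗ[k] Lb k X →ₗ[k] Lb k X :=
  (leibnizIdeal k X).liftQ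
    { toFun := fun a => (leibnizIdeal k X).mapQ (leibnizIdeal k X) (LinearMap.mulLeft k a)
        (fun _ hy => idealSpan_mul_left a hy)
      map_add' := fun a b => by
        refine LinearMap.ext fun y => ?_
        obtain ⟨y, rfl⟩ := mk_surjective k X y
        exact congrArg (mk k X) (add_mul a b y)
      map_smul' := fun c a => by
        refine LinearMap.ext fun y => ?_
        obtain ⟨y, rfl⟩ := mk_surjective k X y
        exact congrArg (mk k X) (smul_mul_assoc c a y) }
    (fun a ha => by
      refine LinearMap.ext fun y => ?_
      obtain ⟨y, rfl⟩ := mk_surjective k X y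
      exact (mk_eq_zero k X).2 (idealSpan_mul_right y ha))

instance : NonUnitalNonAssocRing (Lb k X) :=
  { (inferInstance : AddCommGroup (Lb k X)) with
    mul := fun x y => mulMap k X x y
    left_distrib := fun x y z => map_add (mulMap k X x) y z
    right_distrib := fun x y z => LinearMap.map_add₂ (mulMap k X) x y z
    zero_mul := fun x => LinearMap.map_zero₂ (mulMap k X) x
    mul_zero := fun x => map_zero (mulMap k X x) }

instance : IsScalarTower k (Lb k X) (Lb k X) :=
  ⟨fun c x y => LinearMap.map_smul₂ (mulMap k X) c x y⟩

instance : SMulCommClass k (Lb k X) (Lb k X) :=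
  ⟨fun c x y => ((mulMap k X x).map_smul c y).symm⟩

theorem mk_mul (f g : FreeNonUnitalNonAssocAlgebra k X) :
    mk k X (f * g) = mk k X f * mk k X g := rfl

/-- The Leibniz identity. -/
theorem leibniz (x y z : Lb k X) : x * (y * z) = (x * y) * z - (x * z) * y := by
  obtain ⟨x, rfl⟩ := mk_surjective k X x
  obtain ⟨y, rfl⟩ := mk_surjective k X y
  obtain ⟨z, rfl⟩ := mk_surjective k X z
  have h : mk k X (x * (y * z) - (x * y) * z + (x * z) * y) = 0 :=
    (mk_eq_zero k X).2 (subset_idealSpan ⟨x, y, z, rfl⟩)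
  simp only [map_add, map_sub, mk_mul] at h
  rw [← sub_eq_zero, ← h]
  abel

variable {X}

/-- The generator of `Lb(X)` given by a letter. -/
def of (a : X) : Lb k X := mk k X (FreeNonUnitalNonAssocAlgebra.of k a)

variable {k}

/-- `[f a₁ ⋯ aₘ]_L = ((⋯((f a₁) a₂)⋯) aₘ)` for `f ∈ Lb(X)` and letters `a₁, …, aₘ`. -/
def append (f : Lb k X) (l : List X) : Lb k X := l.foldl (fun g a => g * of k a) f

variable (k)

/-- The left-normed word `[a₁ a₂ ⋯ aₙ]_L`, where the nonempty word `a₁ a₂ ⋯ aₙ` is an element of the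
free semigroup. The set `NF(X)` consists of these elements. -/
def nf (w : FreeSemigroup X) : Lb k X := append (of k w.head) w.tail

end Lb

/-! ### The left-normed words form a linear basis of the free Leibniz algebra -/

/-- The linear map of the free nonunital associative algebra with `a ↦ a` and
`w a ↦ λ(w) a - a λ(w)`. -/
def lam : MonoidAlgebra k (FreeSemigroup X) →ₗ[k] MonoidAlgebra k (FreeSemigroup X) :=
  Finsupp.linearCombination k (fun w : FreeSemigroup X =>
    w.tail.foldl (fun f a => f * MonoidAlgebra.single (FreeSemigroup.of a) (1 : k)
      - MonoidAlgebra.single (FreeSemigroup.of a) (1 : k) * f)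
      (MonoidAlgebra.single (FreeSemigroup.of w.head) (1 : k))) ∘ₗ
    (MonoidAlgebra.coeffLinearEquiv k).toLinearMap

variable {k X}

theorem lam_of (a : X) : lam k X (MonoidAlgebra.single (FreeSemigroup.of a) 1)
    = MonoidAlgebra.single (FreeSemigroup.of a) 1 := by
  simp [lam]

theorem lam_single_mul_of (w : FreeSemigroup X) (a : X) :
    lam k X (MonoidAlgebra.single (w * FreeSemigroup.of a) 1)
    = lam k X (MonoidAlgebra.single w 1) * MonoidAlgebra.single (FreeSemigroup.of a) 1
      - MonoidAlgebra.single (FreeSemigroup.of a) 1 * lam k X (MonoidAlgebra.single w 1) := by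
  simp [lam]

theorem word_induction {P : FreeSemigroup X → Prop} (h1 : ∀ a, P (FreeSemigroup.of a))
    (h2 : ∀ w a, P w → P (w * FreeSemigroup.of a)) (w : FreeSemigroup X) : P w := by
  obtain ⟨a, l⟩ := w
  induction l using List.reverseRecOn with
  | nil => exact h1 a
  | append_singleton l b ih => exact h2 ⟨a, l⟩ b ih

theorem linear_ext {M : Type*} [AddCommMonoid M] [Module k M]
    {f g : MonoidAlgebra k (FreeSemigroup X) →ₗ[k] M}
    (h : ∀ w, f (MonoidAlgebra.single w 1) = g (MonoidAlgebra.single w 1)) : f = g := by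
  ext w
  exact h w

theorem lam_mul_of (f : MonoidAlgebra k (FreeSemigroup X)) (a : X) :
    lam k X (f * MonoidAlgebra.single (FreeSemigroup.of a) 1)
    = lam k X f * MonoidAlgebra.single (FreeSemigroup.of a) 1
      - MonoidAlgebra.single (FreeSemigroup.of a) 1 * lam k X f := by
  have : lam k X ∘ₗ LinearMap.mulRight k (MonoidAlgebra.single (FreeSemigroup.of a) 1)
      = LinearMap.mulRight k (MonoidAlgebra.single (FreeSemigroup.of a) 1) ∘ₗ lam k X
        - LinearMap.mulLeft k (MonoidAlgebra.single (FreeSemigroup.of a) 1) ∘ₗ lam k X := by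
    refine linear_ext fun w => ?_
    simpa [MonoidAlgebra.single_mul_single] using lam_single_mul_of w a
  exact LinearMap.congr_fun this f

theorem lam_mul_lam_single (w : FreeSemigroup X) :
    ∀ f, lam k X (f * lam k X (MonoidAlgebra.single w 1))
      = lam k X f * lam k X (MonoidAlgebra.single w 1)
        - lam k X (MonoidAlgebra.single w 1) * lam k X f := by
  induction w using word_induction with
  | h1 a => intro f; rw [lam_of, lam_mul_of]
  | h2 w a ih =>
    intro f
    rw [lam_single_mul_of, mul_sub, map_sub, ← mul_assoc, ← mul_assoc, lam_mul_of, ih, ih,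
      lam_mul_of]
    noncomm_ring

theorem lam_mul_lam (f g : MonoidAlgebra k (FreeSemigroup X)) :
    lam k X (f * lam k X g) = lam k X f * lam k X g - lam k X g * lam k X f := by
  have : lam k X ∘ₗ LinearMap.mulLeft k f ∘ₗ lam k X
      = LinearMap.mulLeft k (lam k X f) ∘ₗ lam k X
        - LinearMap.mulRight k (lam k X f) ∘ₗ lam k X :=
    linear_ext fun w => lam_mul_lam_single w f
  exact LinearMap.congr_fun this g

variable (k X)

/-- The space of linear combinations of nonempty words with the Leibniz product `f λ(g)`. -/
def Model : Type _ := MonoidAlgebra k (FreeSemigroup X)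

instance : AddCommGroup (Model k X) :=
  inferInstanceAs (AddCommGroup (MonoidAlgebra k (FreeSemigroup X)))

instance : Module k (Model k X) :=
  inferInstanceAs (Module k (MonoidAlgebra k (FreeSemigroup X)))

/-- The identity map onto the model. -/
def toModel : MonoidAlgebra k (FreeSemigroup X) ≃ₗ[k] Model k X := LinearEquiv.refl k _

/-- The product of the model. -/
def modelMul : Model k X →ₗ[k] Model k X →ₗ[k] Model k X :=
  (LinearMap.mul k (MonoidAlgebra k (FreeSemigroup X))).compl₂ (lam k X)

instance : NonUnitalNonAssocRing (Model k X) :=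
  { (inferInstance : AddCommGroup (Model k X)) with
    mul := fun x y => modelMul k X x y
    left_distrib := fun x y z => map_add (modelMul k X x) y z
    right_distrib := fun x y z => LinearMap.map_add₂ (modelMul k X) x y z
    zero_mul := fun x => LinearMap.map_zero₂ (modelMul k X) x
    mul_zero := fun x => map_zero (modelMul k X x) }

instance : IsScalarTower k (Model k X) (Model k X) :=
  ⟨fun c x y => LinearMap.map_smul₂ (modelMul k X) c x y⟩

instance : SMulCommClass k (Model k X) (Model k X) :=
  ⟨fun c x y => ((modelMul k X x).map_smul c y).symm⟩

theorem toModel_mul (f g : MonoidAlgebra k (FreeSemigroup X)) :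
    toModel k X f * toModel k X g = toModel k X (f * lam k X g) := rfl

theorem model_leibniz (x y z : Model k X) : x * (y * z) = (x * y) * z - (x * z) * y := by
  obtain ⟨x, rfl⟩ := (toModel k X).surjective x
  obtain ⟨y, rfl⟩ := (toModel k X).surjective y
  obtain ⟨z, rfl⟩ := (toModel k X).surjective z
  simp only [toModel_mul, ← map_sub, lam_mul_lam]
  congr 1
  noncomm_ring

/-- The homomorphism from the free nonassociative algebra to the model. -/
def freeToModel : FreeNonUnitalNonAssocAlgebra k X →ₙₐ[k] Model k X :=
  FreeNonUnitalNonAssocAlgebra.lift k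
    (fun a => toModel k X (MonoidAlgebra.single (FreeSemigroup.of a) 1))

/-- The homomorphism from `Lb(X)` to the model. -/
def lbToModel : Lb k X →ₗ[k] Model k X :=
  (leibnizIdeal k X).liftQ (freeToModel k X : FreeNonUnitalNonAssocAlgebra k X →ₗ[k] Model k X) <| by
    refine idealSpan_le ?_ ?_
    · rintro _ ⟨x, y, z, rfl⟩
      change freeToModel k X _ = 0
      simp only [map_add, map_sub, map_mul]
      rw [model_leibniz]
      abel
    · intro x y hy
      change freeToModel k X y = 0 at hy
      constructor
      · change freeToModel k X (x * y) = 0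
        rw [map_mul, hy, mul_zero]
      · change freeToModel k X (y * x) = 0
        rw [map_mul, hy, zero_mul]

variable {X}

theorem lbToModel_mul (f g : Lb k X) :
    lbToModel k X (f * g) = lbToModel k X f * lbToModel k X g := by
  obtain ⟨f, rfl⟩ := Lb.mk_surjective k X f
  obtain ⟨g, rfl⟩ := Lb.mk_surjective k X g
  exact map_mul (freeToModel k X) f g

theorem lbToModel_of (a : X) :
    lbToModel k X (Lb.of k a) = toModel k X (MonoidAlgebra.single (FreeSemigroup.of a) 1) :=
  FreeNonUnitalNonAssocAlgebra.lift_of_apply k _ a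

theorem Lb.nf_of (a : X) : Lb.nf k (FreeSemigroup.of a) = Lb.of k a := rfl

theorem Lb.nf_mul_of (w : FreeSemigroup X) (a : X) :
    Lb.nf k (w * FreeSemigroup.of a) = Lb.nf k w * Lb.of k a := by
  simp [Lb.nf, Lb.append]

theorem lbToModel_nf (w : FreeSemigroup X) :
    lbToModel k X (Lb.nf k w) = toModel k X (MonoidAlgebra.single w 1) := by
  induction w using word_induction with
  | h1 a => rw [Lb.nf_of, lbToModel_of]
  | h2 w a ih =>
    rw [Lb.nf_mul_of, lbToModel_mul, ih, lbToModel_of, toModel_mul, lam_of,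
      MonoidAlgebra.single_mul_single, one_mul]

theorem Lb.linearIndependent_nf : LinearIndependent k (Lb.nf k : FreeSemigroup X → Lb k X) := by
  refine LinearIndependent.of_comp
    ((MonoidAlgebra.coeffLinearEquiv k).toLinearMap ∘ₗ (toModel k X).symm.toLinearMap ∘ₗ
      lbToModel k X) ?_
  have h : ((MonoidAlgebra.coeffLinearEquiv k).toLinearMap ∘ₗ (toModel k X).symm.toLinearMap ∘ₗ
      lbToModel k X) ∘ Lb.nf k = (Finsupp.basisSingleOne (R := k) (ι := FreeSemigroup X)) := by
    funext w
    simp [lbToModel_nf]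
  rw [h]
  exact Module.Basis.linearIndependent _

theorem Lb.mul_nf_mem (w : FreeSemigroup X) :
    ∀ f ∈ Submodule.span k (Set.range (Lb.nf k : FreeSemigroup X → Lb k X)),
      f * Lb.nf k w ∈ Submodule.span k (Set.range (Lb.nf k : FreeSemigroup X → Lb k X)) := by
  induction w using word_induction with
  | h1 a =>
    intro f hf
    induction hf using Submodule.span_induction with
    | mem f hf =>
      obtain ⟨w, rfl⟩ := hf
      exact Submodule.subset_span ⟨w * FreeSemigroup.of a, Lb.nf_mul_of k w a⟩
    | zero => rw [zero_mul]; exact Submodule.zero_mem _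
    | add f g _ _ hf hg => rw [add_mul]; exact Submodule.add_mem _ hf hg
    | smul c f _ hf => rw [smul_mul_assoc]; exact Submodule.smul_mem _ c hf
  | h2 w a ih =>
    intro f hf
    have ha : ∀ g ∈ Submodule.span k (Set.range (Lb.nf k : FreeSemigroup X → Lb k X)),
        g * Lb.of k a ∈ Submodule.span k (Set.range (Lb.nf k : FreeSemigroup X → Lb k X)) := by
      intro g hg
      induction hg using Submodule.span_induction with
      | mem f hf =>
        obtain ⟨w, rfl⟩ := hf
        exact Submodule.subset_span ⟨w * FreeSemigroup.of a, Lb.nf_mul_of k w a⟩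
      | zero => rw [zero_mul]; exact Submodule.zero_mem _
      | add f g _ _ hf hg => rw [add_mul]; exact Submodule.add_mem _ hf hg
      | smul c f _ hf => rw [smul_mul_assoc]; exact Submodule.smul_mem _ c hf
    rw [Lb.nf_mul_of, Lb.leibniz]
    exact Submodule.sub_mem _ (ha _ (ih _ hf)) (ih _ (ha _ hf))

theorem Lb.span_nf : ⊤ ≤ Submodule.span k (Set.range (Lb.nf k : FreeSemigroup X → Lb k X)) := by
  have hmul : ∀ f ∈ Submodule.span k (Set.range (Lb.nf k : FreeSemigroup X → Lb k X)),
      ∀ g ∈ Submodule.span k (Set.range (Lb.nf k : FreeSemigroup X → Lb k X)),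
      f * g ∈ Submodule.span k (Set.range (Lb.nf k : FreeSemigroup X → Lb k X)) := by
    intro f hf g hg
    induction hg using Submodule.span_induction with
    | mem g hg => obtain ⟨w, rfl⟩ := hg; exact Lb.mul_nf_mem k w f hf
    | zero => rw [mul_zero]; exact Submodule.zero_mem _
    | add g h _ _ hg hh => rw [mul_add]; exact Submodule.add_mem _ hg hh
    | smul c g _ hg => rw [mul_smul_comm]; exact Submodule.smul_mem _ c hg
  rintro f -
  obtain ⟨f, rfl⟩ := Lb.mk_surjective k X f
  induction f using MonoidAlgebra.induction_linear with
  | zero => rw [map_zero]; exact Submodule.zero_mem _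
  | add f g hf hg => rw [map_add]; exact Submodule.add_mem _ hf hg
  | single m c =>
    have hm : Lb.mk k X (MonoidAlgebra.single m 1)
        ∈ Submodule.span k (Set.range (Lb.nf k : FreeSemigroup X → Lb k X)) := by
      induction m with
      | ih1 a => exact Submodule.subset_span ⟨FreeSemigroup.of a, rfl⟩
      | ih2 x y hx hy =>
        have := hmul _ hx _ hy
        rwa [← Lb.mk_mul, MonoidAlgebra.single_mul_single, one_mul] at this
    have : (MonoidAlgebra.single m c : FreeNonUnitalNonAssocAlgebra k X)
        = c • MonoidAlgebra.single m 1 := by simp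
    rw [this, map_smul]
    exact Submodule.smul_mem _ c hm

/-- The linear basis `NF(X)` of `Lb(X)`, indexed by the nonempty words over `X`. -/
def Lb.nfBasis : Module.Basis (FreeSemigroup X) k (Lb k X) :=
  Module.Basis.mk (Lb.linearIndependent_nf k) (Lb.span_nf k)

theorem Lb.nfBasis_apply (w : FreeSemigroup X) : Lb.nfBasis k w = Lb.nf k w :=
  Module.Basis.mk_apply _ _ w

/-! ### Gröbner-Shirshov bases in the free Leibniz algebra -/

variable {k}

/-- The set `supp(f)` of the left-normed words that occur in `f`. -/
def supp (f : Lb k X) : Finset (FreeSemigroup X) := ((Lb.nfBasis k).repr f).support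

/-- The degree of a word for a given degree function on the letters. -/
def wordDeg (deg : X → ℕ+) (w : FreeSemigroup X) : ℕ :=
  ((w.head :: w.tail).map (fun a => (deg a : ℕ))).sum

section order

variable [LinearOrder X] (deg : X → ℕ+)

/-- The weight `(deg(w), ℓ(w), a₁, …, aₙ)` of a word `w = a₁ ⋯ aₙ`, in a lexicographic product.
Words are compared in the deg-length-lex order by comparing their weights. -/
def wt (w : FreeSemigroup X) : ℕ ×ₗ ℕ ×ₗ List X :=
  toLex (wordDeg deg w, toLex (w.length, w.head :: w.tail))

/-- `w` is the leading monomial of `f` (in particular `f ≠ 0`). -/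
def IsLeading (f : Lb k X) (w : FreeSemigroup X) : Prop :=
  w ∈ supp f ∧ ∀ v ∈ supp f, wt deg v ≤ wt deg w

/-- `f` is nonzero and the coefficient of its leading monomial is `1`. -/
def IsMonic (f : Lb k X) : Prop :=
  ∃ w, IsLeading deg f w ∧ (Lb.nfBasis k).repr f w = 1

/-- A monic set: a nonempty set of monic elements. -/
def IsMonicSet (S : Set (Lb k X)) : Prop :=
  S.Nonempty ∧ ∀ s ∈ S, IsMonic deg s

/-- `h` is a normal polynomial `h_s` built on `s`: either `h = [s a₁ ⋯ aₘ]_L` with `m ≥ 0`, or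
`ℓ(s̄) = 1` and `h = [a₁ ⋯ aₜ s aₜ₊₁ ⋯ aₘ]_L` with `1 ≤ t ≤ m`. -/
def IsNormal (s h : Lb k X) : Prop :=
  (∃ l : List X, h = Lb.append s l) ∨
  ((∃ w, IsLeading deg s w ∧ w.length = 1) ∧
    ∃ (u : FreeSemigroup X) (l : List X), h = Lb.append (Lb.nf k u * s) l)

/-- `f ≡ 0 mod (S, w)`: `f` is a linear combination of normal `S`-polynomials whose leading
monomials are smaller than `w`. -/
def TrivialModWord (S : Set (Lb k X)) (w : FreeSemigroup X) (f : Lb k X) : Prop :=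
  f ∈ Submodule.span k
    {h | ∃ s ∈ S, IsNormal deg s h ∧ ∃ v, IsLeading deg h v ∧ wt deg v < wt deg w}

/-- `f ≡ 0 mod (S, n)`: `f` is a linear combination of normal `S`-polynomials whose leading
monomials have degree at most `n`. -/
def TrivialModDeg (S : Set (Lb k X)) (n : ℕ) (f : Lb k X) : Prop :=
  f ∈ Submodule.span k
    {h | ∃ s ∈ S, IsNormal deg s h ∧ ∃ v, IsLeading deg h v ∧ wordDeg deg v ≤ n}

/-- A Gröbner-Shirshov basis in `Lb(X)` with respect to the deg-length-lex order: a monic set all of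
whose left multiplication compositions and inclusion compositions are trivial. -/
def IsGroebnerShirshov (S : Set (Lb k X)) : Prop :=
  IsMonicSet deg S ∧
  (∀ f ∈ S, ∀ w, IsLeading deg f w → 1 < w.length →
    ∀ u : FreeSemigroup X, Lb.nf k u * f ≠ 0 →
      TrivialModDeg deg S (wordDeg deg u + wordDeg deg w) (Lb.nf k u * f)) ∧
  (∀ f ∈ S, ∀ g ∈ S, f ≠ g → ∀ h, IsNormal deg g h →
    ∀ w, IsLeading deg f w → IsLeading deg h w → TrivialModWord deg S w (f - h))

end order

/-! ### The free metabelian Lie algebra -/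

variable (k X)

/-- The free metabelian Lie algebra on `X`: the quotient of the free Lie algebra `L` on `X` by its
second derived ideal `[[L, L], [L, L]]`. -/
abbrev MLie : Type _ :=
  FreeLieAlgebra k X ⧸ LieAlgebra.derivedSeries k (FreeLieAlgebra k X) 2

variable {X}

/-- The generator of the free metabelian Lie algebra given by a letter. -/
def MLie.of (a : X) : MLie k X := LieSubmodule.Quotient.mk (FreeLieAlgebra.of k a)

/-- The left-normed word `[⋯[[a₁, a₂], a₃], ⋯, aₙ]` in the free metabelian Lie algebra. -/
def MLie.word (w : FreeSemigroup X) : MLie k X :=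
  w.tail.foldl (fun f a => ⁅f, MLie.of k a⁆) (MLie.of k w.head)

section metabelian

variable [LinearOrder X]

/-- The set `S` of relations of the free metabelian Lie algebra in `Lb(X)`. -/
def metabelianRelations : Set (Lb k X) :=
  {f | ∃ (w : FreeSemigroup X) (a₁ a₂ : X), 2 ≤ w.length ∧ a₂ < a₁ ∧
    f = Lb.append (Lb.nf k w) [a₁, a₂] - Lb.append (Lb.nf k w) [a₂, a₁]} ∪
  {f | ∃ a b c : X, c < b ∧ b < a ∧
    f = Lb.nf k ⟨b, [a, c]⟩ - Lb.nf k ⟨c, [a, b]⟩ + Lb.nf k ⟨c, [b, a]⟩} ∪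
  {f | ∃ a₁ a₂ : X, a₂ < a₁ ∧ f = Lb.nf k ⟨a₁, [a₂]⟩ + Lb.nf k ⟨a₂, [a₁]⟩} ∪
  {f | ∃ d : X, f = Lb.nf k ⟨d, [d]⟩}

/-- The words `a₁ a₂ ⋯ aₙ`, `n ≥ 1`, with `a₁ < a₂` and `a₁ ≤ a₃ ≤ ⋯ ≤ aₙ` (conditions on letters
that do not occur are void). -/
def IsBasisWord : FreeSemigroup X → Prop
  | ⟨_, []⟩ => True
  | ⟨a₁, a₂ :: l⟩ => a₁ < a₂ ∧ (a₁ :: l).Pairwise (· ≤ ·)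

end metabelian

end LeibnizGS

end

noncomputable section

namespace LeibnizGS

/-! ### Leading words for the degree function with constant value `1` -/

section leading

variable {k X : Type*} [Field k]

/-! No composition is computed. The homomorphism π from `Lb k X` to the free metabelian Lie algebra
decides everything.

Every relation has a leading word of length at least 2, so its normal polynomials are just the `[s
a₁ ⋯ aₘ]`. Right multiplication by letters respects leading words. A word that is not a basis word
always contains a pattern that makes it the leading word of such a polynomial
(`exists_normal_of_not_isBasisWord`). Well-founded induction then writes any `f` as `b + n`, with
`b` in the span of the basis words and `n` a combination of normal polynomials whose leading words
lie in any prescribed down-closed set `P` containing `supp f` (`mem_reduction`).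

π kills the relations, hence `n`. The images of the basis words are linearly independent
(`linearIndependent_basisWord`), by a Magnus-type representation `a ↦ (e_a, x_a)` in pairs over the
polynomial ring, where `[a b l]` becomes `x_b x_l e_a - x_a x_l e_b`. So `π f = 0` forces `b = 0`,
and `f` is a combination of normal polynomials bounded by `P` (`mem_span_normalsIn`).

Compositions lie in the kernel of π, so suitable choices of `P` give both Gröbner–Shirshov
conditions. Taking `P` to be all words gives the kernel, and the reduction together with
independence gives the basis. -/

/-- Right multiplication of a word by a list of letters. -/
def wordAppend (w : FreeSemigroup X) (l : List X) : FreeSemigroup X := ⟨w.head, w.tail ++ l⟩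

theorem append_nf (w : FreeSemigroup X) (l : List X) :
    Lb.append (Lb.nf k w) l = Lb.nf k (wordAppend w l) := by
  simp [Lb.nf, Lb.append, wordAppend]

theorem supp_subset_iff (f : Lb k X) (s : Set (FreeSemigroup X)) :
    f ∈ Submodule.span k (Lb.nf k '' s) ↔ ↑(supp f) ⊆ s := by
  have : Lb.nf k '' s = Lb.nfBasis k '' s := by
    ext x; simp [Lb.nfBasis_apply]
  rw [this, Module.Basis.mem_span_image]; rfl

theorem repr_nf (w : FreeSemigroup X) :
    (Lb.nfBasis k).repr (Lb.nf k w) = Finsupp.single w 1 := by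
  rw [← Lb.nfBasis_apply, Module.Basis.repr_self]

theorem wordDeg_one (w : FreeSemigroup X) : wordDeg (fun _ : X => (1 : ℕ+)) w = w.length := by
  simp [wordDeg, FreeSemigroup.length, add_comm]

theorem wt_injective (deg : X → ℕ+) : Function.Injective (wt deg) := by
  intro v w h
  have h2 := congrArg (fun t => (ofLex (ofLex t).2).2) h
  simp only [wt, ofLex_toLex, List.cons.injEq] at h2
  exact FreeSemigroup.ext h2.1 h2.2

variable [LinearOrder X]

/-- With all letters of degree 1 the degree is the length, so the order by weight is the shortlex
order, whose well-foundedness is inherited from `X`. -/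
theorem wt_lt_iff {v w : FreeSemigroup X} :
    wt (fun _ : X => (1 : ℕ+)) v < wt (fun _ : X => (1 : ℕ+)) w ↔
      List.Shortlex (· < ·) (v.head :: v.tail) (w.head :: w.tail) := by
  simp only [wt, Prod.Lex.toLex_lt_toLex, wordDeg_one, List.shortlex_def, FreeSemigroup.length,
    List.length_cons]
  have : List.Lex (· < ·) (v.head :: v.tail) (w.head :: w.tail) ↔
    (v.head :: v.tail) < (w.head :: w.tail) := Iff.rfl
  rw [this]
  tauto

theorem wt_wellFounded [WellFoundedLT X] :
    WellFounded (fun v w : FreeSemigroup X =>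
      wt (fun _ : X => (1 : ℕ+)) v < wt (fun _ : X => (1 : ℕ+)) w) := by
  have h := InvImage.wf (fun w : FreeSemigroup X => w.head :: w.tail)
    (List.Shortlex.wf (wellFounded_lt (α := X)))
  refine Subrelation.wf (fun {v w} hvw => ?_) h
  exact wt_lt_iff.1 hvw

/-- Equal length is essential: it excludes that `l₁` is a proper prefix of `l₂`, where appending
could reverse the order. -/
theorem lt_append_of_lt {l₁ l₂ : List X} (t : List X) (hlen : l₁.length = l₂.length)
    (h : l₁ < l₂) : l₁ ++ t < l₂ ++ t := by
  induction l₁ generalizing l₂ with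
  | nil => cases l₂ with
    | nil => exact absurd h (lt_irrefl _)
    | cons b l₂ => simp at hlen
  | cons a l₁ ih => cases l₂ with
    | nil => simp at hlen
    | cons b l₂ =>
      simp only [List.cons_append, List.cons_lt_cons_iff] at h ⊢
      rcases h with h | ⟨rfl, h⟩
      · exact Or.inl h
      · exact Or.inr ⟨rfl, ih (by simpa using hlen) h⟩

/-- The words of the same length as `w` that precede `w` lexicographically. -/
def lowerWords (w : FreeSemigroup X) : Set (FreeSemigroup X) :=
  {v | v.length = w.length ∧ (v.head :: v.tail) < (w.head :: w.tail)}

/-- `f` is homogeneous with leading word `w` and leading coefficient `1`. -/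
def LeadsWith (f : Lb k X) (w : FreeSemigroup X) : Prop :=
  f - Lb.nf k w ∈ Submodule.span k (Lb.nf k '' lowerWords w)

theorem wt_lt_of_mem_lowerWords {v w : FreeSemigroup X} (h : v ∈ lowerWords w) :
    wt (fun _ : X => (1 : ℕ+)) v < wt (fun _ : X => (1 : ℕ+)) w :=
  wt_lt_iff.2 (List.Shortlex.of_lex (by simpa [FreeSemigroup.length] using h.1) h.2)

theorem LeadsWith.nf_add {w : FreeSemigroup X} {g : Lb k X}
    (h : g ∈ Submodule.span k (Lb.nf k '' lowerWords w)) : LeadsWith (Lb.nf k w + g) w := by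
  simpa [LeadsWith] using h

theorem LeadsWith.repr_self {f : Lb k X} {w : FreeSemigroup X} (h : LeadsWith f w) :
    (Lb.nfBasis k).repr f w = 1 := by
  have h1 := (supp_subset_iff _ _).1 h
  have h2 : w ∉ supp (f - Lb.nf k w) := fun hw => lt_irrefl _ (h1 hw).2
  simp only [supp, Finsupp.mem_support_iff, not_not, map_sub, repr_nf, Finsupp.sub_apply,
    Finsupp.single_eq_same] at h2
  exact sub_eq_zero.1 h2

theorem LeadsWith.mem_supp {f : Lb k X} {w v : FreeSemigroup X} (h : LeadsWith f w)
    (hv : v ∈ supp f) : v = w ∨ v ∈ lowerWords w := by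
  have h1 := (supp_subset_iff _ _).1 h
  by_cases hvw : v = w
  · exact Or.inl hvw
  · refine Or.inr (h1 ?_)
    simp only [supp, Finset.mem_coe, Finsupp.mem_support_iff, map_sub, repr_nf,
      Finsupp.sub_apply] at hv ⊢
    rwa [Finsupp.single_eq_of_ne hvw, sub_zero]

theorem LeadsWith.isLeading {f : Lb k X} {w : FreeSemigroup X} (h : LeadsWith f w) :
    IsLeading (fun _ : X => (1 : ℕ+)) f w := by
  refine ⟨by simp [supp, h.repr_self], fun v hv => ?_⟩
  rcases h.mem_supp hv with rfl | hv
  · exact le_rfl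
  · exact (wt_lt_of_mem_lowerWords hv).le

theorem IsLeading.unique {deg : X → ℕ+} {f : Lb k X} {v w : FreeSemigroup X}
    (hv : IsLeading deg f v) (hw : IsLeading deg f w) : v = w :=
  wt_injective deg (le_antisymm (hw.2 v hv.1) (hv.2 w hw.1))

/-- Right multiplication by a letter maps left-normed words to left-normed words and keeps their
order within one length. -/
theorem LeadsWith.mul_of {f : Lb k X} {w : FreeSemigroup X} (h : LeadsWith f w) (a : X) :
    LeadsWith (f * Lb.of k a) (w * FreeSemigroup.of a) := by
  have h1 : f * Lb.of k a - Lb.nf k (w * FreeSemigroup.of a)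
      = LinearMap.mulRight k (Lb.of k a) (f - Lb.nf k w) := by
    rw [Lb.nf_mul_of, LinearMap.mulRight_apply, sub_mul]
  rw [LeadsWith, h1]
  refine (Submodule.map_le_iff_le_comap.2 ?_) (Submodule.mem_map_of_mem h)
  rw [Submodule.span_le]
  rintro _ ⟨v, hv, rfl⟩
  refine Submodule.subset_span ⟨v * FreeSemigroup.of a, ⟨?_, ?_⟩, Lb.nf_mul_of k v a⟩
  · simp [hv.1]
  · simpa using lt_append_of_lt [a] (by simpa [FreeSemigroup.length] using hv.1) hv.2

theorem LeadsWith.append {f : Lb k X} {w : FreeSemigroup X} (h : LeadsWith f w) (l : List X) :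
    LeadsWith (Lb.append f l) (wordAppend w l) := by
  induction l generalizing f w with
  | nil => simpa [Lb.append, wordAppend] using h
  | cons a l ih => simpa [Lb.append, wordAppend] using ih (h.mul_of a)

end leading

/-! ### The leading words of the metabelian relations -/

section relations

variable {k X : Type*} [Field k] [LinearOrder X]

theorem leadsWith_swap (w : FreeSemigroup X) {a₁ a₂ : X} (h : a₂ < a₁) :
    LeadsWith (Lb.append (Lb.nf k w) [a₁, a₂] - Lb.append (Lb.nf k w) [a₂, a₁])
      (wordAppend w [a₁, a₂]) := by
  rw [append_nf, append_nf, sub_eq_add_neg]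
  refine LeadsWith.nf_add (Submodule.neg_mem _ 
    (Submodule.subset_span ⟨wordAppend w [a₂, a₁], ⟨?_, ?_⟩, rfl⟩))
  · simp [wordAppend, FreeSemigroup.length]
  · simp only [wordAppend, List.cons_lt_cons_iff, lt_irrefl, true_and, false_or]
    exact List.append_left_lt (by simp [List.cons_lt_cons_iff, h])

theorem leadsWith_jacobi {a b c : X} (hcb : c < b) :
    LeadsWith (Lb.nf k ⟨b, [a, c]⟩ - Lb.nf k ⟨c, [a, b]⟩ + Lb.nf k ⟨c, [b, a]⟩) ⟨b, [a, c]⟩ := by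
  rw [sub_eq_add_neg, add_assoc]
  refine LeadsWith.nf_add (Submodule.add_mem _ (Submodule.neg_mem _ ?_) ?_)
  · exact Submodule.subset_span ⟨⟨c, [a, b]⟩, ⟨rfl, by simp [List.cons_lt_cons_iff, hcb]⟩, rfl⟩
  · exact Submodule.subset_span ⟨⟨c, [b, a]⟩, ⟨rfl, by simp [List.cons_lt_cons_iff, hcb]⟩, rfl⟩

theorem leadsWith_skew {a b : X} (h : b < a) :
    LeadsWith (Lb.nf k ⟨a, [b]⟩ + Lb.nf k ⟨b, [a]⟩) ⟨a, [b]⟩ :=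
  LeadsWith.nf_add (Submodule.subset_span ⟨⟨b, [a]⟩, ⟨rfl, by simp [List.cons_lt_cons_iff, h]⟩, rfl⟩)

theorem leadsWith_nf (w : FreeSemigroup X) : LeadsWith (Lb.nf k w) w := by
  simp [LeadsWith]

/-- Every relation has a leading word, of length at least two. -/
theorem exists_leadsWith {s : Lb k X} (hs : s ∈ metabelianRelations k) :
    ∃ w, LeadsWith s w ∧ 2 ≤ w.length := by
  rcases hs with ((⟨w, a, b, hw, hab, rfl⟩ | ⟨a, b, c, hcb, hba, rfl⟩) | ⟨a, b, hab, rfl⟩) |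
    ⟨d, rfl⟩
  · exact ⟨_, leadsWith_swap w hab, by simp [wordAppend, FreeSemigroup.length]⟩
  · exact ⟨_, leadsWith_jacobi hcb, by simp [FreeSemigroup.length]⟩
  · exact ⟨_, leadsWith_skew hab, by simp [FreeSemigroup.length]⟩
  · exact ⟨_, leadsWith_nf _, by simp [FreeSemigroup.length]⟩

/-- Every word that is not a basis word is the leading word of a normal polynomial. -/
theorem exists_normal_of_not_isBasisWord {w : FreeSemigroup X} (hw : ¬ IsBasisWord w) :
    ∃ s ∈ metabelianRelations k, ∃ l : List X, LeadsWith (Lb.append s l : Lb k X) w := by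
  obtain ⟨a, l⟩ := w
  cases l with
  | nil => exact absurd trivial hw
  | cons b l =>
    by_cases hab : a < b
    · have hl : ¬ (a :: l).Pairwise (· ≤ ·) := fun h => hw ⟨hab, h⟩
      rw [← List.isChain_iff_pairwise, List.isChain_iff_forall_rel_of_append_cons_cons] at hl
      push Not at hl
      -- A descent `x > y` of neighbours in `a :: l`, the word without its second letter `b`. At the
      -- front it gives `a b y ⋯` with `y < a < b`, led by a Jacobi relation. Further on it is a
      -- swap behind the prefix `a b p`, of length at least 2.
      obtain ⟨x, y, p, q, hpq, hyx⟩ := hl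
      cases p with
      | nil =>
        obtain ⟨rfl, rfl⟩ : a = x ∧ l = y :: q := by simpa using hpq
        exact ⟨_, Or.inl (Or.inl (Or.inr ⟨b, a, y, hyx, hab, rfl⟩)), q,
          (leadsWith_jacobi hyx).append q⟩
      | cons c p =>
        obtain ⟨rfl, rfl⟩ : a = c ∧ l = p ++ x :: y :: q := by simpa using hpq
        refine ⟨_, Or.inl (Or.inl (Or.inl ⟨⟨a, b :: p⟩, x, y, ?_, hyx, rfl⟩)), q, ?_⟩
        · simp [FreeSemigroup.length]
        · simpa [wordAppend] using (leadsWith_swap (k := k) ⟨a, b :: p⟩ hyx).append q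
    · rcases (not_lt.1 hab).lt_or_eq with hab | rfl
      · exact ⟨_, Or.inl (Or.inr ⟨a, b, hab, rfl⟩), l, (leadsWith_skew hab).append l⟩
      · exact ⟨_, Or.inr ⟨b, rfl⟩, l, (leadsWith_nf _).append l⟩

/-- The normal polynomials of the metabelian relations whose leading word lies in `P`. -/
def normalsIn (k : Type*) [Field k] (P : Set (FreeSemigroup X)) : Set (Lb k X) :=
  {h | ∃ s ∈ metabelianRelations k, IsNormal (fun _ : X => (1 : ℕ+)) s h ∧
    ∃ v, IsLeading (fun _ : X => (1 : ℕ+)) h v ∧ v ∈ P}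

/-- A set of words that contains with each word all smaller ones. -/
def IsDownClosed (P : Set (FreeSemigroup X)) : Prop :=
  ∀ ⦃v w : FreeSemigroup X⦄, wt (fun _ : X => (1 : ℕ+)) v < wt (fun _ : X => (1 : ℕ+)) w →
    w ∈ P → v ∈ P

/-- Reduction of words modulo the metabelian relations. -/
theorem nf_mem_reduction [WellFoundedLT X] {P : Set (FreeSemigroup X)} (hP : IsDownClosed P)
    (w : FreeSemigroup X) (hw : w ∈ P) :
    Lb.nf k w ∈ Submodule.span k (Lb.nf k '' {v | IsBasisWord v}) ⊔
      Submodule.span k (normalsIn k P) := by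
  induction w using (wt_wellFounded (X := X)).induction with
  | h w ih =>
  by_cases hb : IsBasisWord w
  · exact Submodule.mem_sup_left (Submodule.subset_span ⟨w, hb, rfl⟩)
  · obtain ⟨s, hs, l, hl⟩ := exists_normal_of_not_isBasisWord (k := k) hb
    have h1 : Lb.append s l ∈ Submodule.span k (normalsIn k P) :=
      Submodule.subset_span ⟨s, hs, Or.inl ⟨l, rfl⟩, w, hl.isLeading, hw⟩
    have h2 : Submodule.span k (Lb.nf k '' lowerWords w) ≤
        Submodule.span k (Lb.nf k '' {v | IsBasisWord v}) ⊔
          Submodule.span k (normalsIn k P) := by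
      rw [Submodule.span_le]
      rintro _ ⟨v, hv, rfl⟩
      have := wt_lt_of_mem_lowerWords hv
      exact ih v this (hP this hw)
    -- The word is the normal polynomial minus its lower terms, which are already reduced.
    have h3 := Submodule.sub_mem _ (Submodule.mem_sup_right h1) (h2 hl)
    rwa [sub_sub_cancel] at h3

theorem mem_reduction [WellFoundedLT X] {P : Set (FreeSemigroup X)} (hP : IsDownClosed P)
    {f : Lb k X} (hf : ↑(supp f) ⊆ P) :
    f ∈ Submodule.span k (Lb.nf k '' {v | IsBasisWord v}) ⊔
      Submodule.span k (normalsIn k P) := by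
  have h : Submodule.span k (Lb.nf k '' P) ≤
      Submodule.span k (Lb.nf k '' {v | IsBasisWord v}) ⊔ Submodule.span k (normalsIn k P) := by
    rw [Submodule.span_le]
    rintro _ ⟨v, hv, rfl⟩
    exact nf_mem_reduction hP v hv
  exact h ((supp_subset_iff f P).2 hf)

end relations

/-! ### The homomorphism onto the free metabelian Lie algebra -/

section quotient

variable (k X : Type*) [Field k]

/-- The homomorphism of the free nonassociative algebra with `a ↦ a`. -/
def freeToMLie : FreeNonUnitalNonAssocAlgebra k X →ₙₐ[k] CommutatorRing (MLie k X) :=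
  FreeNonUnitalNonAssocAlgebra.lift k (fun a : X => (MLie.of k a : MLie k X))

theorem freeToMLie_of (a : X) :
    freeToMLie k X (FreeNonUnitalNonAssocAlgebra.of k a) = MLie.of k a :=
  FreeNonUnitalNonAssocAlgebra.lift_of_apply k _ a

/-- `freeToMLie` as a linear map to the free metabelian Lie algebra. -/
def freeToMLieLinear : FreeNonUnitalNonAssocAlgebra k X →ₗ[k] MLie k X where
  -- The synonym `CommutatorRing`, which makes the bracket a product for the universal property, is
  -- dropped here.
  toFun := freeToMLie k X
  map_add' := (freeToMLie k X).map_add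
  map_smul' := (freeToMLie k X).map_smul

theorem freeToMLieLinear_mul (f g : FreeNonUnitalNonAssocAlgebra k X) :
    freeToMLieLinear k X (f * g) = ⁅freeToMLieLinear k X f, freeToMLieLinear k X g⁆ :=
  (freeToMLie k X).map_mul f g

/-- The homomorphism from the free Leibniz algebra to the free metabelian Lie algebra. -/
def lbToMLie : Lb k X →ₗ[k] MLie k X :=
  (leibnizIdeal k X).liftQ (freeToMLieLinear k X) <| by
    refine idealSpan_le ?_ ?_
    · rintro _ ⟨x, y, z, rfl⟩
      change freeToMLieLinear k X _ = 0
      simp only [map_add, map_sub, freeToMLieLinear_mul]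
      rw [leibniz_lie, ← lie_skew (freeToMLieLinear k X y) ⁅_, _⁆]
      abel
    · intro x y hy
      change freeToMLieLinear k X y = 0 at hy
      constructor
      · change freeToMLieLinear k X (x * y) = 0
        rw [freeToMLieLinear_mul, hy, lie_zero]
      · change freeToMLieLinear k X (y * x) = 0
        rw [freeToMLieLinear_mul, hy, zero_lie]

variable {X}

theorem lbToMLie_of (a : X) : lbToMLie k X (Lb.of k a) = MLie.of k a :=
  freeToMLie_of k X a

theorem lbToMLie_mul (f g : Lb k X) :
    lbToMLie k X (f * g) = ⁅lbToMLie k X f, lbToMLie k X g⁆ := by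
  obtain ⟨f, rfl⟩ := Lb.mk_surjective k X f
  obtain ⟨g, rfl⟩ := Lb.mk_surjective k X g
  exact freeToMLieLinear_mul k X f g

theorem lbToMLie_append (f : Lb k X) (l : List X) :
    lbToMLie k X (Lb.append f l) = l.foldl (fun g a => ⁅g, MLie.of k a⁆) (lbToMLie k X f) := by
  induction l generalizing f with
  | nil => rfl
  | cons a l ih =>
    have := ih (f * Lb.of k a)
    rwa [lbToMLie_mul, lbToMLie_of] at this

theorem lbToMLie_nf (w : FreeSemigroup X) : lbToMLie k X (Lb.nf k w) = MLie.word k w := by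
  rw [Lb.nf, lbToMLie_append, lbToMLie_of]; rfl

variable (X)

/-- The range of `lbToMLie`, pulled back to a Lie subalgebra of the free Lie algebra. -/
def rangePreimage : LieSubalgebra k (FreeLieAlgebra k X) :=
  { (LinearMap.range (lbToMLie k X)).comap
      (LieSubmodule.Quotient.mk' (LieAlgebra.derivedSeries k (FreeLieAlgebra k X) 2) :
        FreeLieAlgebra k X →ₗ[k] MLie k X) with
    lie_mem' := by
      rintro x y ⟨f, hf⟩ ⟨g, hg⟩
      exact ⟨f * g, by rw [lbToMLie_mul, hf, hg]; rfl⟩ }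

/-- The elements of the free Lie algebra whose class lies in the range form a Lie subalgebra
containing the generators. Lifting the generators into it and including back is the identity, so it
is everything. -/
theorem lbToMLie_surjective : Function.Surjective (lbToMLie k X) := by
  intro y
  obtain ⟨x, rfl⟩ := LieSubmodule.Quotient.surjective_mk' _ y
  let φ : FreeLieAlgebra k X →ₗ⁅k⁆ rangePreimage k X :=
    FreeLieAlgebra.lift k (fun a => ⟨FreeLieAlgebra.of k a, Lb.of k a, lbToMLie_of k a⟩)
  have h : (rangePreimage k X).incl.comp φ = LieHom.id := by
    refine FreeLieAlgebra.hom_ext fun a => ?_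
    simp [φ, FreeLieAlgebra.lift_of_apply]
  have hx : ((φ x : rangePreimage k X) : FreeLieAlgebra k X) = x := LieHom.congr_fun h x
  have := (φ x).2
  rw [hx] at this
  exact this

variable {X}

theorem MLie.lie_lie_lie_eq_zero (x y z w : MLie k X) : ⁅⁅x, y⁆, ⁅z, w⁆⁆ = 0 := by
  obtain ⟨x, rfl⟩ := LieSubmodule.Quotient.surjective_mk' _ x
  obtain ⟨y, rfl⟩ := LieSubmodule.Quotient.surjective_mk' _ y
  obtain ⟨z, rfl⟩ := LieSubmodule.Quotient.surjective_mk' _ z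
  obtain ⟨w, rfl⟩ := LieSubmodule.Quotient.surjective_mk' _ w
  have h : ⁅⁅x, y⁆, ⁅z, w⁆⁆ ∈ LieAlgebra.derivedSeries k (FreeLieAlgebra k X) 2 := by
    change _ ∈ ⁅⁅(⊤ : LieIdeal k (FreeLieAlgebra k X)), (⊤ : LieIdeal k (FreeLieAlgebra k X))⁆,
      ⁅(⊤ : LieIdeal k (FreeLieAlgebra k X)), (⊤ : LieIdeal k (FreeLieAlgebra k X))⁆⁆
    exact LieSubmodule.lie_mem_lie (LieSubmodule.lie_mem_lie trivial trivial)
      (LieSubmodule.lie_mem_lie trivial trivial)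
  exact (LieSubmodule.Quotient.mk_eq_zero _).2 h

/-- By the Leibniz identity the first relation is `μ (a₁ a₂)`, a product of two products, so it
vanishes in a metabelian algebra. The others express the Jacobi identity, antisymmetry and `⁅d, d⁆ =
0`. -/
theorem lbToMLie_eq_zero_of_mem [LinearOrder X] {s : Lb k X} (hs : s ∈ metabelianRelations k) :
    lbToMLie k X s = 0 := by
  rcases hs with ((⟨⟨c, l⟩, a, b, hw, hab, rfl⟩ | ⟨a, b, c, hcb, hba, rfl⟩) | ⟨a, b, hab, rfl⟩) |
    ⟨d, rfl⟩
  -- Length at least 2 lets the last letter split off, which exhibits `μ` as a product.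
  · obtain ⟨l, d, rfl⟩ : ∃ l' d, l = l' ++ [d] := by
      rcases List.eq_nil_or_concat' l with rfl | h
      · simp [FreeSemigroup.length] at hw
      · exact h
    have h : Lb.append (Lb.nf k ⟨c, l ++ [d]⟩) [a, b] - Lb.append (Lb.nf k ⟨c, l ++ [d]⟩) [b, a]
        = (Lb.nf k ⟨c, l⟩ * Lb.of k d) * (Lb.of k a * Lb.of k b) := by
      rw [Lb.leibniz]; simp [Lb.append, Lb.nf]
    rw [h, lbToMLie_mul, lbToMLie_mul, lbToMLie_mul, MLie.lie_lie_lie_eq_zero]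
  · simp only [map_add, map_sub, lbToMLie_nf, MLie.word, List.foldl]
    rw [lie_lie (MLie.of k b), ← lie_skew (MLie.of k c) (MLie.of k a),
      ← lie_skew (MLie.of k c) (MLie.of k b), ← lie_skew _ (MLie.of k b),
      ← lie_skew _ (MLie.of k a)]
    simp only [lie_neg]
    abel
  · simp only [map_add, lbToMLie_nf, MLie.word, List.foldl]
    rw [← lie_skew, neg_add_cancel]
  · simp only [lbToMLie_nf, MLie.word, List.foldl, lie_self]

end quotient

/-! ### A metabelian Lie algebra in which the basis words are linearly independent -/

/-- The Lie algebra of pairs `(m, r)` with `m` in an `R`-module `N` and `r ∈ R`, with the bracket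
`[(m, r), (m', r')] = (r' m - r m', 0)`. -/
@[ext]
structure Metab (R N : Type*) where
  /-- The component in the module. -/
  fst : N
  /-- The component in the ring. -/
  snd : R

namespace Metab

variable {R N : Type*}

/-- The obvious bijection with the product. -/
def equivProd : Metab R N ≃ N × R where
  toFun x := (x.fst, x.snd)
  invFun x := ⟨x.1, x.2⟩
  left_inv _ := rfl
  right_inv _ := rfl

variable [CommRing R] [AddCommGroup N]

instance : AddCommGroup (Metab R N) := equivProd.addCommGroup

theorem add_fst (x y : Metab R N) : (x + y).fst = x.fst + y.fst := rfl
theorem add_snd (x y : Metab R N) : (x + y).snd = x.snd + y.snd := rfl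
theorem zero_fst : (0 : Metab R N).fst = 0 := rfl
theorem zero_snd : (0 : Metab R N).snd = 0 := rfl

section scalars

variable {k : Type*} [CommRing k] [Algebra k R] [Module k N]

instance : Module k (Metab R N) := equivProd.module k

theorem smul_fst (c : k) (x : Metab R N) : (c • x).fst = c • x.fst := rfl
theorem smul_snd (c : k) (x : Metab R N) : (c • x).snd = c • x.snd := rfl

end scalars

variable [Module R N]

instance : Bracket (Metab R N) (Metab R N) :=
  ⟨fun x y => ⟨y.snd • x.fst - x.snd • y.fst, 0⟩⟩

theorem lie_fst (x y : Metab R N) : ⁅x, y⁆.fst = y.snd • x.fst - x.snd • y.fst := rfl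
theorem lie_snd (x y : Metab R N) : ⁅x, y⁆.snd = 0 := rfl

instance : LieRing (Metab R N) where
  add_lie x y z := by
    ext
    · simp only [lie_fst, add_fst, add_snd, smul_add, add_smul]; abel
    · simp only [lie_snd, add_snd, add_zero]
  lie_add x y z := by
    ext
    · simp only [lie_fst, add_fst, add_snd, smul_add, add_smul]; abel
    · simp only [lie_snd, add_snd, add_zero]
  lie_self x := by
    ext
    · simp only [lie_fst, zero_fst, sub_self]
    · rfl
  leibniz_lie x y z := by
    ext
    · simp only [lie_fst, lie_snd, add_fst, zero_smul, sub_zero, zero_sub, smul_sub, smul_smul,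
        mul_comm z.snd]
      rw [mul_comm x.snd y.snd]
      abel
    · simp only [lie_snd, add_snd, add_zero]

variable {k : Type*} [CommRing k] [Algebra k R] [Module k N] [IsScalarTower k R N]

instance : LieAlgebra k (Metab R N) where
  lie_smul c x y := by
    ext
    · simp only [lie_fst, smul_fst, smul_snd, smul_sub, smul_assoc]
      rw [smul_comm x.snd c]
    · simp only [lie_snd, smul_snd, smul_zero]

/-- The projection to the module, as a linear map. -/
def fstLinear : Metab R N →ₗ[k] N where
  toFun := fst
  map_add' _ _ := rfl
  map_smul' _ _ := rfl

/-- Brackets have ring component 0, and two elements with ring component 0 commute. -/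
theorem derivedSeries_two (L : Type*) [LieRing L] [LieAlgebra k L] (φ : L →ₗ⁅k⁆ Metab R N) :
    LieAlgebra.derivedSeries k L 2 ≤ φ.ker := by
  have h1 : ∀ x ∈ LieAlgebra.derivedSeries k L 1, (φ x).snd = 0 := by
    intro x hx
    change x ∈ (LieAlgebra.derivedSeries k L 1 : Submodule k L) at hx
    rw [LieAlgebra.coe_derivedSeries_one_eq] at hx
    induction hx using Submodule.span_induction with
    | mem x hx => obtain ⟨y, z, rfl⟩ := hx; rw [LieHom.map_lie, lie_snd]
    | zero => rw [map_zero, zero_snd]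
    | add x y _ _ hx hy => rw [map_add, add_snd, hx, hy, add_zero]
    | smul c x _ hx => rw [map_smul, smul_snd, hx, smul_zero]
  change ⁅LieAlgebra.derivedSeries k L 1, LieAlgebra.derivedSeries k L 1⁆ ≤ _
  rw [LieSubmodule.lie_le_iff]
  intro x hx y hy
  rw [LieHom.mem_ker, LieHom.map_lie]
  ext
  · rw [lie_fst, h1 x hx, h1 y hy, zero_smul, zero_smul, sub_zero, zero_fst]
  · rfl

end Metab

section independence

variable (k X : Type*) [Field k] [DecidableEq X]

/-- The homomorphism of the free Lie algebra with `a ↦ (e_a, a)`. -/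
def freeLieToMetab :
    FreeLieAlgebra k X →ₗ⁅k⁆ Metab (MvPolynomial X k) (X → MvPolynomial X k) :=
  FreeLieAlgebra.lift k (fun a => ⟨Pi.single a 1, MvPolynomial.X a⟩)

/-- The linear map induced by `freeLieToMetab` on the free metabelian Lie algebra. -/
def mLieToMetab : MLie k X →ₗ[k] Metab (MvPolynomial X k) (X → MvPolynomial X k) :=
  (LieAlgebra.derivedSeries k (FreeLieAlgebra k X) 2).toSubmodule.liftQ
    (freeLieToMetab k X : FreeLieAlgebra k X →ₗ[k] _)
    (fun _ hx => LinearMap.mem_ker.2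
      (LieHom.mem_ker.1 (Metab.derivedSeries_two _ (freeLieToMetab k X) hx)))

variable {X}

theorem mLieToMetab_of (a : X) :
    mLieToMetab k X (MLie.of k a) = ⟨Pi.single a 1, MvPolynomial.X a⟩ :=
  FreeLieAlgebra.lift_of_apply _ a

theorem mLieToMetab_lie (x y : MLie k X) :
    mLieToMetab k X ⁅x, y⁆ = ⁅mLieToMetab k X x, mLieToMetab k X y⁆ := by
  obtain ⟨x, rfl⟩ := LieSubmodule.Quotient.surjective_mk' _ x
  obtain ⟨y, rfl⟩ := LieSubmodule.Quotient.surjective_mk' _ y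
  exact (freeLieToMetab k X).map_lie x y

/-- The exponent vector of a word. -/
def exponent (l : List X) : X →₀ ℕ := Multiset.toFinsupp (l : Multiset X)

theorem exponent_cons (a : X) (l : List X) :
    exponent (a :: l) = Finsupp.single a 1 + exponent l := by
  rw [exponent, ← Multiset.cons_coe, ← Multiset.singleton_add, map_add,
    Multiset.toFinsupp_singleton]; rfl

theorem exponent_eq_iff {l₁ l₂ : List X} : exponent l₁ = exponent l₂ ↔ l₁.Perm l₂ := by
  rw [exponent, exponent, EmbeddingLike.apply_eq_iff_eq, Multiset.coe_eq_coe]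

/-- On elements with ring component 0, bracketing with the letter `a` is multiplication by the
variable of `a`, so only the multiset of letters matters. -/
theorem mLieToMetab_foldl (x : MLie k X) (hx : (mLieToMetab k X x).snd = 0) (l : List X) :
    mLieToMetab k X (l.foldl (fun f a => ⁅f, MLie.of k a⁆) x)
      = ⟨MvPolynomial.monomial (exponent l) (1 : k) • (mLieToMetab k X x).fst, 0⟩ := by
  induction l generalizing x with
  | nil =>
    ext1
    · simp [exponent]
    · exact hx
  | cons a l ih =>
    rw [List.foldl_cons, ih _ (by rw [mLieToMetab_lie]; rfl), mLieToMetab_lie, Metab.lie_fst, hx,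
      zero_smul, sub_zero, mLieToMetab_of, smul_smul, exponent_cons, MvPolynomial.X,
      MvPolynomial.monomial_mul, add_comm, one_mul]

theorem mLieToMetab_word_singleton (a : X) :
    (mLieToMetab k X (MLie.word k ⟨a, []⟩)).fst = Pi.single a 1 := by
  rw [MLie.word, List.foldl_nil, mLieToMetab_of]

theorem mLieToMetab_word (a b : X) (l : List X) :
    (mLieToMetab k X (MLie.word k ⟨a, b :: l⟩)).fst
      = Pi.single a (MvPolynomial.monomial (exponent (b :: l)) 1)
        - Pi.single b (MvPolynomial.monomial (exponent (a :: l)) 1) := by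
  have h : MLie.word k ⟨a, b :: l⟩
    = l.foldl (fun f a => ⁅f, MLie.of k a⁆) ⁅MLie.of k a, MLie.of k b⁆ := rfl
  rw [h, mLieToMetab_foldl _ _ (by rw [mLieToMetab_lie]; rfl), mLieToMetab_lie, Metab.lie_fst,
    mLieToMetab_of, mLieToMetab_of, smul_sub, exponent_cons, exponent_cons]
  simp only [← Pi.single_smul, smul_eq_mul, mul_one, MvPolynomial.X, MvPolynomial.monomial_mul]
  rw [add_comm (exponent l), add_comm (exponent l)]

/-- The coordinate of the metabelian model that detects a basis word. -/
def detect : FreeSemigroup X → X × List X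
  | ⟨a, []⟩ => (a, [])
  -- The `b`-coordinate is used because its monomial comes from `a :: l`, which is sorted in a basis
  -- word and hence recoverable from its exponent.
  | ⟨a, b :: l⟩ => (b, a :: l)

/-- The linear form that reads off the coordinate given by `detect`. -/
def detectForm (w : FreeSemigroup X) : MLie k X →ₗ[k] k :=
  (MvPolynomial.lcoeff k (exponent (detect w).2) : MvPolynomial X k →ₗ[k] k) ∘ₗ
    (LinearMap.proj (detect w).1 : (X → MvPolynomial X k) →ₗ[k] MvPolynomial X k) ∘ₗ
    (Metab.fstLinear : Metab (MvPolynomial X k) (X → MvPolynomial X k) →ₗ[k] _) ∘ₗ mLieToMetab k X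

theorem detectForm_apply (w : FreeSemigroup X) (x : MLie k X) :
    detectForm k w x =
      MvPolynomial.coeff (exponent (detect w).2) ((mLieToMetab k X x).fst (detect w).1) := rfl

end independence

section independence

variable (k : Type*) {X : Type*} [Field k] [LinearOrder X]

theorem detectForm_self {w : FreeSemigroup X} (hw : IsBasisWord w) :
    detectForm k w (MLie.word k w) ≠ 0 := by
  obtain ⟨a, l⟩ := w
  cases l with
  | nil => simp [detectForm_apply, detect, mLieToMetab_word_singleton, exponent]
  | cons b l =>
    have hab : b ≠ a := hw.1.ne'
    -- The value is -1, from the second term of the word's image.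
    simp [detectForm_apply, detect, mLieToMetab_word, Pi.single_eq_of_ne hab]

theorem detectForm_of_ne {v w : FreeSemigroup X} (hv : IsBasisWord v) (hw : IsBasisWord w)
    (hvw : v ≠ w) : detectForm k v (MLie.word k w) = 0 := by
  rw [detectForm_apply]
  obtain ⟨c, m⟩ := v
  obtain ⟨a, l⟩ := w
  cases l with
  | nil =>
    rw [mLieToMetab_word_singleton]
    cases m with
    | nil =>
      have : c ≠ a := fun h => hvw (by rw [h])
      simp [detect, Pi.single_eq_of_ne this]
    | cons d m =>
      have h0 : exponent (c :: m) ≠ 0 := by simp [exponent]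
      simp only [detect]
      by_cases hda : d = a
      · subst hda
        rw [Pi.single_eq_same, MvPolynomial.coeff_one, if_neg h0.symm]
      · simp [Pi.single_eq_of_ne hda]
  | cons b l =>
    rw [mLieToMetab_word, Pi.sub_apply, MvPolynomial.coeff_sub]
    have h1 : MvPolynomial.coeff (exponent (detect (⟨c, m⟩ : FreeSemigroup X)).2)
        ((Pi.single a (MvPolynomial.monomial (exponent (b :: l)) 1) : X → MvPolynomial X k)
          (detect (⟨c, m⟩ : FreeSemigroup X)).1) = 0 := by
      by_cases h : (detect (⟨c, m⟩ : FreeSemigroup X)).1 = a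
      · rw [h, Pi.single_eq_same, MvPolynomial.coeff_monomial, if_neg]
        rw [exponent_eq_iff]
        cases m with
        | nil => simp [detect]
        | cons d m =>
          -- Here `c < d = a`, but `c` would have to be a letter of `b :: l`, all of which are at
          -- least `a`.
          intro hp
          have hc : c ∈ b :: l := hp.mem_iff.2 (by simp [detect])
          have hda : d = a := h
          have hca : c < a := hda ▸ hv.1
          rcases List.mem_cons.1 hc with rfl | hc
          · exact lt_asymm hca hw.1
          · exact not_lt.2 (List.rel_of_pairwise_cons hw.2 hc) hca
      · rw [Pi.single_eq_of_ne h, MvPolynomial.coeff_zero]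
    have h2 : MvPolynomial.coeff (exponent (detect (⟨c, m⟩ : FreeSemigroup X)).2)
        ((Pi.single b (MvPolynomial.monomial (exponent (a :: l)) 1) : X → MvPolynomial X k)
          (detect (⟨c, m⟩ : FreeSemigroup X)).1) = 0 := by
      by_cases h : (detect (⟨c, m⟩ : FreeSemigroup X)).1 = b
      · rw [h, Pi.single_eq_same, MvPolynomial.coeff_monomial, if_neg]
        rw [exponent_eq_iff]
        cases m with
        | nil => simp [detect]
        | cons d m =>
          intro hp
          have hdb : d = b := h
          -- Two sorted lists that are permutations of each other coincide.
          have hal := hp.eq_of_pairwise' hw.2 hv.2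
          simp only [List.cons.injEq] at hal
          exact hvw (by rw [hdb, hal.1, hal.2])
      · rw [Pi.single_eq_of_ne h, MvPolynomial.coeff_zero]
    rw [h1, h2, sub_zero]

/-- The basis words are linearly independent in the free metabelian Lie algebra. -/
theorem linearIndependent_basisWord :
    LinearIndependent k
      (fun w : {w : FreeSemigroup X // IsBasisWord w} => MLie.word k w.1) := by
  rw [linearIndependent_iff']
  intro s g hg w hw
  have h := congrArg (detectForm k w.1) hg
  rw [map_sum, map_zero, Finset.sum_eq_single_of_mem w hw, map_smul, smul_eq_mul] at h
  · exact (mul_eq_zero.1 h).resolve_right (detectForm_self k w.2)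
  · intro v _ hvw
    rw [map_smul, detectForm_of_ne k w.2 v.2 (fun h => hvw (Subtype.ext h.symm)), smul_zero]

end independence

/-! ### The grading by length -/

section grading

variable {k X : Type*} [Field k]

/-- The span of the words of length `n`. -/
def homogeneous (k X : Type*) [Field k] (n : ℕ) : Submodule k (Lb k X) :=
  Submodule.span k (Lb.nf k '' {v | v.length = n})

theorem mul_of_mem_homogeneous {n : ℕ} {f : Lb k X} (hf : f ∈ homogeneous k X n) (a : X) :
    f * Lb.of k a ∈ homogeneous k X (n + 1) := by
  have h : homogeneous k X n ≤
      (homogeneous k X (n + 1)).comap (LinearMap.mulRight k (Lb.of k a)) := by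
    rw [homogeneous, Submodule.span_le]
    rintro _ ⟨v, hv, rfl⟩
    refine Submodule.subset_span ⟨v * FreeSemigroup.of a, ?_, Lb.nf_mul_of k v a⟩
    rw [Set.mem_ofPred_eq] at hv ⊢
    rw [FreeSemigroup.length_mul, hv, FreeSemigroup.length_of]
  exact h hf

theorem mul_nf_mem_homogeneous (w : FreeSemigroup X) {n : ℕ} {f : Lb k X}
    (hf : f ∈ homogeneous k X n) : f * Lb.nf k w ∈ homogeneous k X (n + w.length) := by
  induction w using word_induction generalizing n f with
  | h1 a => exact mul_of_mem_homogeneous hf a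
  | h2 w a ih =>
    rw [Lb.nf_mul_of, Lb.leibniz, FreeSemigroup.length_mul, FreeSemigroup.length_of]
    have h1 := mul_of_mem_homogeneous (ih hf) a
    have h2 := ih (mul_of_mem_homogeneous hf a)
    rw [add_right_comm, add_assoc] at h2
    exact Submodule.sub_mem _ h1 h2

/-- The Leibniz identity preserves length; this bounds the degree of a left multiplication
composition. -/
theorem mul_mem_homogeneous {n m : ℕ} {f g : Lb k X} (hf : f ∈ homogeneous k X n)
    (hg : g ∈ homogeneous k X m) : f * g ∈ homogeneous k X (n + m) := by
  have h : homogeneous k X m ≤ (homogeneous k X (n + m)).comap (LinearMap.mulLeft k f) := by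
    rw [homogeneous, Submodule.span_le]
    rintro _ ⟨v, rfl, rfl⟩
    exact mul_nf_mem_homogeneous v hf
  exact h hg

end grading

/-! ### The Gröbner-Shirshov basis -/

section main

variable {k X : Type*} [Field k]

theorem lbToMLie_append_eq_zero {f : Lb k X} (hf : lbToMLie k X f = 0) (l : List X) :
    lbToMLie k X (Lb.append f l) = 0 := by
  rw [lbToMLie_append, hf]
  induction l with
  | nil => rfl
  | cons a l ih => rwa [List.foldl_cons, zero_lie]

theorem append_mem_idealSpan {S : Set (Lb k X)} {f : Lb k X} (hf : f ∈ idealSpan k S)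
    (l : List X) : Lb.append f l ∈ idealSpan k S := by
  induction l generalizing f with
  | nil => exact hf
  | cons a l ih => exact ih (idealSpan_mul_right _ hf)

variable [LinearOrder X]

/-- The normal polynomials of the metabelian relations are the elements `[s a₁ ⋯ aₘ]`. -/
theorem exists_append_of_isNormal {s h : Lb k X} (hs : s ∈ metabelianRelations k)
    (hh : IsNormal (fun _ : X => (1 : ℕ+)) s h) : ∃ l, h = Lb.append s l := by
  rcases hh with hh | ⟨⟨w, hw, hw1⟩, -⟩
  · exact hh
  · obtain ⟨v, hv, hv2⟩ := exists_leadsWith hs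
    obtain rfl := IsLeading.unique hw hv.isLeading
    omega

theorem lbToMLie_eq_zero_of_isNormal {s h : Lb k X} (hs : s ∈ metabelianRelations k)
    (hh : IsNormal (fun _ : X => (1 : ℕ+)) s h) : lbToMLie k X h = 0 := by
  obtain ⟨l, rfl⟩ := exists_append_of_isNormal hs hh
  exact lbToMLie_append_eq_zero (lbToMLie_eq_zero_of_mem k hs) l

theorem repr_eq_one_of_isNormal {s h : Lb k X} {w : FreeSemigroup X}
    (hs : s ∈ metabelianRelations k) (hh : IsNormal (fun _ : X => (1 : ℕ+)) s h)
    (hw : IsLeading (fun _ : X => (1 : ℕ+)) h w) : (Lb.nfBasis k).repr h w = 1 := by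
  obtain ⟨l, rfl⟩ := exists_append_of_isNormal hs hh
  obtain ⟨v, hv, -⟩ := exists_leadsWith hs
  rw [IsLeading.unique hw (hv.append l).isLeading]
  exact (hv.append l).repr_self

/-- Independence of the basis words in the quotient makes the projection injective on their span. -/
theorem eq_zero_of_mem_span_basisWords {f : Lb k X}
    (hf : f ∈ Submodule.span k (Lb.nf k '' {v | IsBasisWord v})) (h0 : lbToMLie k X f = 0) :
    f = 0 := by
  rw [Set.image_eq_range, Finsupp.mem_span_range_iff_exists_finsupp] at hf
  obtain ⟨c, rfl⟩ := hf
  have hc : Finsupp.linearCombination k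
      (fun w : {w : FreeSemigroup X // IsBasisWord w} => MLie.word k w.1) c = 0 := by
    rw [← h0, Finsupp.linearCombination_apply, Finsupp.sum, Finsupp.sum, map_sum]
    exact Finset.sum_congr rfl fun w _ => by rw [map_smul, lbToMLie_nf]
  have := linearIndependent_iff.1 (linearIndependent_basisWord (X := X) k) c hc
  rw [this, Finsupp.sum_zero_index]

/-- An element of the kernel of the map to the free metabelian Lie algebra is a linear combination
of normal polynomials, whose leading words are bounded by the words of the element. -/
theorem mem_span_normalsIn [WellFoundedLT X] {P : Set (FreeSemigroup X)} (hP : IsDownClosed P)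
    {f : Lb k X} (hf : ↑(supp f) ⊆ P) (h0 : lbToMLie k X f = 0) :
    f ∈ Submodule.span k (normalsIn k P) := by
  obtain ⟨b, hb, n, hn, rfl⟩ := Submodule.mem_sup.1 (mem_reduction hP hf)
  have hn0 : Submodule.span k (normalsIn k P) ≤ LinearMap.ker (lbToMLie k X) := by
    rw [Submodule.span_le]
    rintro h ⟨s, hs, hh, -⟩
    exact lbToMLie_eq_zero_of_isNormal hs hh
  have hb0 : lbToMLie k X b = 0 := by
    rwa [map_add, LinearMap.mem_ker.1 (hn0 hn), add_zero] at h0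
  rwa [eq_zero_of_mem_span_basisWords hb hb0, zero_add]

theorem ker_lbToMLie [WellFoundedLT X] :
    LinearMap.ker (lbToMLie k X) = idealSpan k (metabelianRelations k) := by
  refine le_antisymm (fun f hf => ?_) (idealSpan_le ?_ ?_)
  · have h := mem_span_normalsIn (P := Set.univ) (fun _ _ _ _ => trivial) (Set.subset_univ _) hf
    refine Submodule.span_le.2 ?_ h
    rintro h ⟨s, hs, hh, -⟩
    obtain ⟨l, rfl⟩ := exists_append_of_isNormal hs hh
    exact append_mem_idealSpan (subset_idealSpan hs) l
  · exact fun s hs => lbToMLie_eq_zero_of_mem k hs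
  · intro x y hy
    rw [LinearMap.mem_ker] at hy
    constructor
    · rw [LinearMap.mem_ker, lbToMLie_mul, hy, lie_zero]
    · rw [LinearMap.mem_ker, lbToMLie_mul, hy, zero_lie]

theorem LeadsWith.mem_homogeneous {f : Lb k X} {w : FreeSemigroup X} (h : LeadsWith f w) :
    f ∈ homogeneous k X w.length := by
  refine (supp_subset_iff _ _).2 fun v hv => ?_
  rcases h.mem_supp hv with rfl | hv
  · rfl
  · exact hv.1

/-- The leading terms cancel, so an inclusion composition lives strictly below `w`. -/
theorem supp_sub_lt {deg : X → ℕ+} {f h : Lb k X} {w : FreeSemigroup X} (hf : IsLeading deg f w)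
    (hh : IsLeading deg h w) (hfh : (Lb.nfBasis k).repr f w = (Lb.nfBasis k).repr h w) :
    ↑(supp (f - h)) ⊆ {v | wt deg v < wt deg w} := by
  intro v hv
  simp only [supp, Finset.mem_coe, Finsupp.mem_support_iff, map_sub, Finsupp.sub_apply] at hv
  refine lt_of_le_of_ne (α := ℕ ×ₗ ℕ ×ₗ List X) ?_ fun hvw => ?_
  · by_cases hvf : v ∈ supp f
    · exact hf.2 v hvf
    · refine hh.2 v ?_
      simp only [supp, Finsupp.mem_support_iff, not_not] at hvf ⊢
      intro hvh
      exact hv (by rw [hvf, hvh, sub_zero])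
  · rw [wt_injective deg hvw, hfh, sub_self] at hv
    exact hv rfl

theorem isGroebnerShirshov_metabelianRelations [WellFoundedLT X] [Nonempty X] :
    IsGroebnerShirshov (fun _ : X => (1 : ℕ+)) (metabelianRelations k) := by
  refine ⟨⟨?_, fun s hs => ?_⟩, ?_, ?_⟩
  · obtain ⟨d⟩ := ‹Nonempty X›
    exact ⟨_, Or.inr ⟨d, rfl⟩⟩
  · obtain ⟨w, hw, -⟩ := exists_leadsWith hs
    exact ⟨w, hw.isLeading, hw.repr_self⟩
  · intro f hf w hw _ u _
    obtain ⟨v, hv, -⟩ := exists_leadsWith hf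
    obtain rfl := IsLeading.unique hw hv.isLeading
    refine mem_span_normalsIn (P := {v | wordDeg (fun _ : X => (1 : ℕ+)) v ≤ _}) ?_ ?_ ?_
    -- The degree is the first component of the weight, so a degree bound is down-closed.
    · intro v₁ v₂ h12 h2
      rw [Set.mem_ofPred_eq] at h2 ⊢
      refine le_trans ?_ h2
      rcases Prod.Lex.toLex_lt_toLex.1 h12 with h | h
      · exact h.le
      · exact h.1.le
    · have h := (supp_subset_iff _ _).1
        (mul_mem_homogeneous (leadsWith_nf (k := k) u).mem_homogeneous hv.mem_homogeneous)
      intro v₁ hv₁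
      rw [Set.mem_ofPred_eq, wordDeg_one, wordDeg_one, wordDeg_one]
      exact (h hv₁).le
    · rw [lbToMLie_mul, lbToMLie_eq_zero_of_mem k hf, lie_zero]
  · intro f hf g hg _ h hh w hfw hhw
    refine mem_span_normalsIn (P := {v | wt (fun _ : X => (1 : ℕ+)) v < _})
      (fun v₁ v₂ h12 h2 => lt_trans h12 h2) (supp_sub_lt hfw hhw ?_) ?_
    · rw [repr_eq_one_of_isNormal hg hh hhw]
      -- `f` is a normal polynomial built on itself, with no letters appended.
      exact repr_eq_one_of_isNormal hf (Or.inl ⟨[], rfl⟩) hfw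
    · rw [map_sub, lbToMLie_eq_zero_of_mem k hf, lbToMLie_eq_zero_of_isNormal hg hh, sub_zero]

theorem span_basisWord [WellFoundedLT X] :
    ⊤ ≤ Submodule.span k
      (Set.range (fun w : {w : FreeSemigroup X // IsBasisWord w} => MLie.word k w.1)) := by
  rintro y -
  obtain ⟨f, rfl⟩ := lbToMLie_surjective k X y
  obtain ⟨b, hb, n, hn, rfl⟩ := Submodule.mem_sup.1
    (mem_reduction (P := Set.univ) (fun _ _ _ _ => trivial) (Set.subset_univ _) (f := f))
  have hn0 : lbToMLie k X n = 0 := by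
    refine (Submodule.span_le (p := LinearMap.ker (lbToMLie k X))).2 ?_ hn
    rintro h ⟨s, hs, hh, -⟩
    exact lbToMLie_eq_zero_of_isNormal hs hh
  rw [map_add, hn0, add_zero]
  refine Submodule.mem_comap.1 (Submodule.span_le.2 ?_ hb)
  rintro _ ⟨w, hw, rfl⟩
  exact Submodule.subset_span ⟨⟨w, hw⟩, (lbToMLie_nf k w).symm⟩

end main

end LeibnizGS

end

theorem mainTheorem5 {k : Type*} {X : Type*} [Field k] [LinearOrder X] [WellFoundedLT X]
    [Nonempty X] :
    LeibnizGS.IsGroebnerShirshov (fun _ : X => (1 : ℕ+)) (LeibnizGS.metabelianRelations k) ∧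
    (∃ π : LeibnizGS.Lb k X →ₗ[k] LeibnizGS.MLie k X,
      (∀ a : X, π (LeibnizGS.Lb.of k a) = LeibnizGS.MLie.of k a) ∧
      (∀ f g : LeibnizGS.Lb k X, π (f * g) = ⁅π f, π g⁆) ∧
      Function.Surjective π ∧
      LinearMap.ker π = LeibnizGS.idealSpan k (LeibnizGS.metabelianRelations (X := X) k)) ∧
    ∃ B : Module.Basis {w : FreeSemigroup X // LeibnizGS.IsBasisWord w} k (LeibnizGS.MLie k X),
      ∀ w, B w = LeibnizGS.MLie.word k w.1 :=
  ⟨LeibnizGS.isGroebnerShirshov_metabelianRelations,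
    ⟨LeibnizGS.lbToMLie k X, LeibnizGS.lbToMLie_of k, LeibnizGS.lbToMLie_mul k,
      LeibnizGS.lbToMLie_surjective k X, LeibnizGS.ker_lbToMLie⟩,
    Module.Basis.mk (LeibnizGS.linearIndependent_basisWord k) LeibnizGS.span_basisWord,
    fun w => Module.Basis.mk_apply _ _ w⟩
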